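/- Let $k$ be a field. Let $\mathcal C$ be the category of finite sets in which a morphism from $X$ to $Y$ is a correspondence, i.e. a subset of $Y\times X$, with composition $RS=\{(z,x)\mid \exists y,\ (z,y)\in R,\ (y,x)\in S\}$; write $\mathcal C(Y,X)$ for the set of morphisms from $X$ to $Y$ and $k\mathcal C(Y,X)$ for the free $k$-module on it. A correspondence functor over $k$ is a functor from $\mathcal C$ to $k$-modules. Let $E$ be a finite set, $R$ a (partial) order on $E$, $\mathrm{Aut}(E,R)$ the automorphism group of the poset $(E,R)$, and $V$ a simple $k\mathrm{Aut}(E,R)$-module. The simple correspondence functor $S_{E,R,V}$ is defined as follows. Let $\mathcal R_E=k\mathcal C(E,E)$ be the algebra of the monoid of relations on $E$. The algebra of permuted orders $\mathcal P_E$ is the quotient of $\mathcal R_E$ by the two-sided ideal generated by the relations which factor through a set of cardinality $<|E|$ and by the differences $Q-\overline Q$, where $Q$ is a reflexive relation and $\overline Q$ its transitive closure; it has a basis consisting of the $\Delta_\sigma Q$, with $\sigma$ a permutation of $E$, $\Delta_\sigma=\{(\sigma(e),e)\mid e\in E\}$ and $Q$ an order on $E$. Let $f_R=\sum_{Q\supseteq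 R}\mu(R,Q)\,Q\in\mathcal P_E$, where $Q$ runs over the orders on $E$ containing $R$ and $\mu$ is the Möbius function of the set of all orders on $E$, ordered by inclusion. The left ideal $\mathcal P_Ef_R$ is a $(\mathcal P_E,k\mathrm{Aut}(E,R))$-bimodule ($\sigma$ acting on the right by multiplication by $\Delta_\sigma$); put $T_{R,V}=\mathcal P_Ef_R\otimes_{k\mathrm{Aut}(E,R)}V$, an $\mathcal R_E$-module. Finally $S_{E,R,V}=L/J$, where, for every finite set $X$, $L(X)=k\mathcal C(X,E)\otimes_{\mathcal R_E}T_{R,V}$ and $J(X)$ is the set of all $\sum_i\varphi_i\otimes w_i\in L(X)$ such that $\sum_i(\psi\varphi_i)\cdot w_i=0$ for all $\psi\in k\mathcal C(E,X)$; correspondences act by left composition. **Theorem.** (a) There exist a positive integer $N$ and a real number $c>0$ such that, for any finite set $X$ of cardinality at least $N$, the $k$-vector space $S_{E,R,V}(X)$ is finite-dimensional and $$c\,|E|^{|X|}\ \le\ \dim_k S_{E,R,V}(X)\ \le\ \big(2^{|E|}\big)^{|X|}.$$ (b) Let $X$ be any finite set, let $v\in V$ be nonzero, and let $A$ be a set of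 representatives of the orbits of $\mathrm{Aut}(E,R)$, acting by composition on the left, on the set of all surjective maps $X\to E$. For $\varphi\in A$ put $\Lambda_\varphi=\{(x,e)\in X\times E\mid(\varphi(x),e)\in R\}\in\mathcal C(X,E)$. Then the classes of $\Lambda_\varphi\otimes f_R\otimes v$ in $S_{E,R,V}(X)$, for $\varphi\in A$, are linearly independent over $k$. -/

import Mathlib

open scoped TensorProduct
open CategoryTheory

universe u v w

noncomputable section

namespace CorrFun

/-! ### Correspondences -/

/-- A correspondence from `X` to `Y` is a subset of `Y × X` (target first). -/
structure Corr (Y X : Type u) : Type u where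
  graph : Set (Y × X)

namespace Corr

instance (Y X : Type u) : Membership (Y × X) (Corr Y X) where
  mem R p := p ∈ R.graph

theorem mem_mk {Y X : Type u} {s : Set (Y × X)} {p : Y × X} :
    p ∈ (⟨s⟩ : Corr Y X) ↔ p ∈ s := Iff.rfl

theorem graph_injective (Y X : Type u) :
    Function.Injective (Corr.graph : Corr Y X → Set (Y × X)) := by
  rintro ⟨s⟩ ⟨t⟩ h
  exact congrArg Corr.mk h

theorem ext {Y X : Type u} {R S : Corr Y X} (h : ∀ y x, (y, x) ∈ R ↔ (y, x) ∈ S) : R = S :=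
  graph_injective Y X (Set.ext fun p => h p.1 p.2)

/-- Correspondences are ordered by inclusion. -/
instance (Y X : Type u) : PartialOrder (Corr Y X) :=
  PartialOrder.lift Corr.graph (graph_injective Y X)

theorem le_def {Y X : Type u} {R S : Corr Y X} :
    R ≤ S ↔ ∀ y x, (y, x) ∈ R → (y, x) ∈ S :=
  ⟨fun h _ _ hr => h hr, fun h p hp => h p.1 p.2 hp⟩

instance (Y X : Type u) [Finite Y] [Finite X] : Finite (Corr Y X) :=
  Finite.of_injective _ (graph_injective Y X)

/-- The diagonal `Δ_X`. -/
def id (X : Type u) : Corr X X := ⟨{p : X × X | p.1 = p.2}⟩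

/-- The composite `RS` of `R ⊆ Z × Y` and `S ⊆ Y × X`. -/
def comp {Z Y X : Type u} (R : Corr Z Y) (S : Corr Y X) : Corr Z X :=
  ⟨{p : Z × X | ∃ y, (p.1, y) ∈ R ∧ (y, p.2) ∈ S}⟩

theorem mem_id {X : Type u} {x y : X} : (x, y) ∈ id X ↔ x = y := Iff.rfl

theorem mem_comp {Z Y X : Type u} {R : Corr Z Y} {S : Corr Y X} {z : Z} {x : X} :
    (z, x) ∈ comp R S ↔ ∃ y, (z, y) ∈ R ∧ (y, x) ∈ S := Iff.rfl

theorem id_comp {Y X : Type u} (R : Corr Y X) : comp (id Y) R = R :=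
  ext fun y x => by simp [mem_comp, mem_id]

theorem comp_id {Y X : Type u} (R : Corr Y X) : comp R (id X) = R :=
  ext fun y x => by simp [mem_comp, mem_id]

theorem comp_assoc {W Z Y X : Type u} (R : Corr W Z) (S : Corr Z Y) (T : Corr Y X) :
    comp (comp R S) T = comp R (comp S T) :=
  ext fun a b => by
    simp only [mem_comp]
    constructor
    · rintro ⟨y, ⟨z, h1, h2⟩, h3⟩
      exact ⟨z, h1, y, h2, h3⟩
    · rintro ⟨z, h1, y, h2, h3⟩
      exact ⟨y, ⟨z, h1, h2⟩, h3⟩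

/-- The monoid `C(E,E)` of all relations on `E`. -/
instance (E : Type u) : Monoid (Corr E E) where
  mul := comp
  one := id E
  mul_assoc := comp_assoc
  one_mul := id_comp
  mul_one := comp_id

theorem mem_mul {E : Type u} {Q S : Corr E E} {a b : E} :
    (a, b) ∈ Q * S ↔ ∃ y, (a, y) ∈ Q ∧ (y, b) ∈ S := Iff.rfl

/-- `Δ_σ = {(σ(x), x)}`. -/
def perm {E : Type u} (σ : Equiv.Perm E) : Corr E E := ⟨{p : E × E | p.1 = σ p.2}⟩

theorem mem_perm {E : Type u} {σ : Equiv.Perm E} {a b : E} :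
    (a, b) ∈ perm σ ↔ a = σ b := Iff.rfl

/-- The transitive closure of a relation. -/
def transClosure {E : Type u} (Q : Corr E E) : Corr E E :=
  ⟨{p : E × E | Relation.TransGen (fun a b => (a, b) ∈ Q) p.1 p.2}⟩

/-- A relation on `E` is inessential if it factors through a set of cardinality `< |E|`. -/
def Inessential {E : Type u} (Q : Corr E E) : Prop :=
  ∃ (Y : Type u) (_ : Finite Y) (A : Corr E Y) (B : Corr Y E),
    Nat.card Y < Nat.card E ∧ Q = comp A B

end Corr

/-! ### The category of finite sets and correspondences -/

/-- A finite set, viewed as an object of the category of correspondences. -/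
structure FinCorr : Type (u + 1) where
  carrier : Type u
  [finite : Finite carrier]

attribute [instance] FinCorr.finite

/-- Morphisms from `X` to `Y` are the correspondences from `X` to `Y`. -/
instance : Category.{u} FinCorr.{u} where
  Hom X Y := Corr Y.carrier X.carrier
  id X := Corr.id X.carrier
  comp S R := Corr.comp R S
  id_comp R := Corr.comp_id R
  comp_id R := Corr.id_comp R
  assoc T S R := (Corr.comp_assoc R S T).symm

/-- The algebra `R_E = k C(E,E)` of the monoid of all relations on `E`. -/
abbrev RelAlg (k : Type v) [Field k] (E : Type u) : Type (max u v) :=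
  MonoidAlgebra k (Corr E E)

/-- `kC(Y,X)`, the free `k`-module with basis `C(Y,X)`. -/
def Lin (k : Type v) [Field k] (Y X : Type u) : Type (max u v) := Corr Y X →₀ k

namespace Lin

variable (k : Type v) [Field k] {Y X : Type u}

instance (Y X : Type u) : AddCommGroup (Lin k Y X) :=
  inferInstanceAs (AddCommGroup (Corr Y X →₀ k))

instance (Y X : Type u) : Module k (Lin k Y X) :=
  inferInstanceAs (Module k (Corr Y X →₀ k))

/-- The canonical basis of `kC(Y,X)`. -/
def basis (Y X : Type u) : Module.Basis (Corr Y X) k (Lin k Y X) :=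
  ⟨LinearEquiv.refl k (Corr Y X →₀ k)⟩

/-- A correspondence, as an element of `kC(Y,X)`. -/
def of (φ : Corr Y X) : Lin k Y X := basis k Y X φ

/-- Linear extension of a map defined on the basis. -/
def lift {M : Type*} [AddCommGroup M] [Module k M] (f : Corr Y X → M) : Lin k Y X →ₗ[k] M :=
  (basis k Y X).constr k f

@[simp] theorem lift_of {M : Type*} [AddCommGroup M] [Module k M] (f : Corr Y X → M)
    (φ : Corr Y X) : lift k f (of k φ) = f φ :=
  (basis k Y X).constr_basis k f φ

end Lin

/-! ### The functors `L_{E,W}` and `S_{E,W} = L_{E,W} / J_{E,W}` -/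

section Functors

variable (k : Type v) [Field k] (E : Type u) (W : Type w) [AddCommGroup W] [Module k W]
  [Module (RelAlg k E) W]

/-- The relations `φρ ⊗ w = φ ⊗ ρw` which define the tensor product over `R_E` as a quotient of
the tensor product over `k`; it suffices to impose them for `φ`, `ρ` in the canonical bases. -/
def LRel (X : Type u) : Submodule k (Lin k X E ⊗[k] W) :=
  Submodule.span k {t | ∃ (φ : Corr X E) (ρ : Corr E E) (x : W),
    t = Lin.of k (Corr.comp φ ρ) ⊗ₜ[k] x
      - Lin.of k φ ⊗ₜ[k] (MonoidAlgebra.of k (Corr E E) ρ • x)}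

/-- `L_{E,W}(X) = kC(X,E) ⊗_{R_E} W`. -/
abbrev LObj (X : Type u) : Type (max u v w) := (Lin k X E ⊗[k] W) ⧸ LRel k E W X

/-- The class of `φ ⊗ x` in `L_{E,W}(X)`. -/
def LObj.mk {X : Type u} (φ : Corr X E) (x : W) : LObj k E W X :=
  (LRel k E W X).mkQ (Lin.of k φ ⊗ₜ[k] x)

variable {k E W}

theorem LObj.mk_comp {X : Type u} (φ : Corr X E) (ρ : Corr E E) (x : W) :
    LObj.mk k E W (Corr.comp φ ρ) x
      = LObj.mk k E W φ (MonoidAlgebra.of k (Corr E E) ρ • x) := by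
  rw [← sub_eq_zero]
  unfold LObj.mk
  rw [← map_sub]
  exact (Submodule.Quotient.mk_eq_zero _).2 (Submodule.subset_span ⟨φ, ρ, x, rfl⟩)

theorem LObj.hom_ext {X : Type u} {M : Type*} [AddCommGroup M] [Module k M]
    {f g : LObj k E W X →ₗ[k] M}
    (h : ∀ φ x, f (LObj.mk k E W φ x) = g (LObj.mk k E W φ x)) : f = g := by
  apply Submodule.linearMap_qext
  apply TensorProduct.ext
  apply (Lin.basis k X E).ext
  intro φ
  ext x
  exact h φ x

variable (k E W)

/-- The action `L_{E,W}(X) → L_{E,W}(Y)`, `φ ⊗ x ↦ Uφ ⊗ x`, of a correspondence `U`. -/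
def LMap {X Y : Type u} (U : Corr Y X) : LObj k E W X →ₗ[k] LObj k E W Y :=
  (LRel k E W X).mapQ (LRel k E W Y)
    (LinearMap.rTensor W (Lin.lift k fun φ => Lin.of k (Corr.comp U φ))) (by
      rw [LRel, Submodule.span_le]
      rintro t ⟨φ, ρ, x, rfl⟩
      refine Submodule.subset_span ⟨Corr.comp U φ, ρ, x, ?_⟩
      simp [Corr.comp_assoc])

@[simp] theorem LMap_mk {X Y : Type u} (U : Corr Y X) (φ : Corr X E) (x : W) :
    LMap k E W U (LObj.mk k E W φ x) = LObj.mk k E W (Corr.comp U φ) x := by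
  simp [LMap, LObj.mk]

theorem LMap_id (X : Type u) : LMap k E W (Corr.id X) = LinearMap.id :=
  LObj.hom_ext fun φ x => by simp [Corr.id_comp]

theorem LMap_comp {X Y Z : Type u} (U : Corr Z Y) (T : Corr Y X) :
    LMap k E W (Corr.comp U T) = LMap k E W U ∘ₗ LMap k E W T :=
  LObj.hom_ext fun φ x => by simp [Corr.comp_assoc]

variable [IsScalarTower k (RelAlg k E) W]

/-- The canonical map `L_{E,W}(E) → W`, `φ ⊗ x ↦ φx`. -/
def LEval : LObj k E W E →ₗ[k] W :=
  (LRel k E W E).liftQ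
    (TensorProduct.lift (Lin.lift k fun φ : Corr E E =>
      Algebra.lsmul k k W (MonoidAlgebra.of k (Corr E E) φ))) (by
      rw [LRel, Submodule.span_le]
      rintro t ⟨φ, ρ, x, rfl⟩
      have h : MonoidAlgebra.of k (Corr E E) (Corr.comp φ ρ)
          = MonoidAlgebra.of k (Corr E E) φ * MonoidAlgebra.of k (Corr E E) ρ :=
        map_mul _ φ ρ
      simp only [SetLike.mem_coe, LinearMap.mem_ker, map_sub, TensorProduct.lift.tmul,
        Lin.lift_of, h,
        Algebra.lsmul_coe, mul_smul, sub_self])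

@[simp] theorem LEval_mk (φ : Corr E E) (x : W) :
    LEval k E W (LObj.mk k E W φ x) = MonoidAlgebra.of k (Corr E E) φ • x := by
  simp [LEval, LObj.mk]

/-- `J_{E,W}(X)`: the elements `∑ᵢ φᵢ ⊗ xᵢ` of `L_{E,W}(X)` such that `∑ᵢ (ψφᵢ)xᵢ = 0` in `W`
for all `ψ`. By linearity it suffices to take `ψ` in the basis `C(E,X)` of `kC(E,X)`. -/
def JObj (X : Type u) : Submodule k (LObj k E W X) :=
  ⨅ ψ : Corr E X, LinearMap.ker (LEval k E W ∘ₗ LMap k E W ψ)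

/-- `S_{E,W}(X) = L_{E,W}(X) / J_{E,W}(X)`. -/
abbrev SObj (X : Type u) : Type (max u v w) := LObj k E W X ⧸ JObj k E W X

/-- The class in `S_{E,W}(X)` of `φ ⊗ x`. -/
def SObj.mk {X : Type u} (φ : Corr X E) (x : W) : SObj k E W X :=
  (JObj k E W X).mkQ (LObj.mk k E W φ x)

/-- The action of a correspondence on `S_{E,W}`. -/
def SMap {X Y : Type u} (U : Corr Y X) : SObj k E W X →ₗ[k] SObj k E W Y :=
  (JObj k E W X).mapQ (JObj k E W Y) (LMap k E W U) (by
    intro a ha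
    simp only [JObj, Submodule.mem_comap, Submodule.mem_iInf, LinearMap.mem_ker] at ha ⊢
    intro ψ
    have h := ha (Corr.comp ψ U)
    rwa [LMap_comp] at h)

/-- The correspondence functor `S_{E,W} = L_{E,W} / J_{E,W}`, for an `R_E`-module `W`. -/
def SFunctor : FinCorr.{u} ⥤ ModuleCat.{max u v w} k where
  obj X := ModuleCat.of k (SObj k E W X.carrier)
  map {X Y} U := ModuleCat.ofHom (SMap k E W (X := X.carrier) (Y := Y.carrier) U)
  map_id X := by
    apply ModuleCat.hom_ext
    apply Submodule.linearMap_qext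
    apply LinearMap.ext
    intro a
    change (JObj k E W X.carrier).mkQ (LMap k E W (Corr.id X.carrier) a) = _
    rw [LMap_id]
    rfl
  map_comp {X Y Z} T U := by
    apply ModuleCat.hom_ext
    apply Submodule.linearMap_qext
    apply LinearMap.ext
    intro a
    change (JObj k E W Z.carrier).mkQ (LMap k E W (Corr.comp U T) a) = _
    rw [LMap_comp]
    rfl

end Functors

/-! ### Orders on a set and their automorphisms -/

/-- An order on `E`: a reflexive, antisymmetric, transitive relation. Orders are themselves
ordered by inclusion. -/
structure OrderRel (E : Type u) : Type u where
  rel : Corr E E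
  refl : ∀ a, (a, a) ∈ rel
  antisymm : ∀ a b, (a, b) ∈ rel → (b, a) ∈ rel → a = b
  trans : ∀ a b c, (a, b) ∈ rel → (b, c) ∈ rel → (a, c) ∈ rel

theorem OrderRel.rel_injective (E : Type u) :
    Function.Injective (OrderRel.rel : OrderRel E → Corr E E) := by
  rintro ⟨R, _, _, _⟩ ⟨S, _, _, _⟩ h
  cases h
  rfl

instance (E : Type u) : PartialOrder (OrderRel E) :=
  PartialOrder.lift OrderRel.rel (OrderRel.rel_injective E)

theorem OrderRel.le_def {E : Type u} {R S : OrderRel E} :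
    R ≤ S ↔ ∀ a b, (a, b) ∈ R.rel → (a, b) ∈ S.rel := Corr.le_def

theorem OrderRel.ext {E : Type u} {R S : OrderRel E}
    (h : ∀ a b, (a, b) ∈ R.rel ↔ (a, b) ∈ S.rel) : R = S :=
  OrderRel.rel_injective E (Corr.ext h)

instance (E : Type u) [Finite E] : Finite (OrderRel E) :=
  Finite.of_injective _ (OrderRel.rel_injective E)

instance (E : Type u) [Finite E] : Fintype (OrderRel E) := Fintype.ofFinite _

open Classical in
instance (E : Type u) [Finite E] : LocallyFiniteOrder (OrderRel E) :=
  Fintype.toLocallyFiniteOrder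

/-- `Aut(E,R)`, the group of automorphisms of the poset `(E,R)`. -/
def OrderRel.aut {E : Type u} (R : OrderRel E) : Subgroup (Equiv.Perm E) where
  carrier := {σ | ∀ a b, (σ a, σ b) ∈ R.rel ↔ (a, b) ∈ R.rel}
  mul_mem' {σ τ} hσ hτ a b := (hσ (τ a) (τ b)).trans (hτ a b)
  one_mem' _ _ := Iff.rfl
  inv_mem' {σ} hσ a b := by
    have h := hσ (σ.symm a) (σ.symm b)
    rw [Equiv.apply_symm_apply, Equiv.apply_symm_apply] at h
    exact h.symm

/-- The conjugate order `{(σ(e), σ(f)) | (e,f) ∈ R}`. -/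
def OrderRel.conj {E : Type u} (σ : Equiv.Perm E) (R : OrderRel E) : OrderRel E where
  rel := ⟨{p : E × E | (σ.symm p.1, σ.symm p.2) ∈ R.rel}⟩
  refl _ := R.refl _
  antisymm _ _ h1 h2 := σ.symm.injective (R.antisymm _ _ h1 h2)
  trans _ _ _ h1 h2 := R.trans _ _ _ h1 h2

theorem OrderRel.mem_conj {E : Type u} {σ : Equiv.Perm E} {R : OrderRel E} {a b : E} :
    (a, b) ∈ (R.conj σ).rel ↔ (σ.symm a, σ.symm b) ∈ R.rel := Iff.rfl

/-- Conjugation as an automorphism of the poset of orders on `E`. -/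
def OrderRel.conjIso {E : Type u} (σ : Equiv.Perm E) : OrderRel E ≃o OrderRel E where
  toFun := OrderRel.conj σ
  invFun := OrderRel.conj σ.symm
  left_inv R := OrderRel.ext fun a b => by simp [OrderRel.mem_conj]
  right_inv R := OrderRel.ext fun a b => by simp [OrderRel.mem_conj]
  map_rel_iff' {R S} := by
    simp only [Equiv.coe_fn_mk, OrderRel.le_def, OrderRel.mem_conj]
    constructor
    · intro h a b hab
      simpa using h (σ a) (σ b) (by simpa using hab)
    · intro h a b hab
      exact h _ _ hab

theorem OrderRel.conj_eq_self {E : Type u} {R : OrderRel E} {σ : Equiv.Perm E}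
    (hσ : σ ∈ R.aut) : R.conj σ = R :=
  OrderRel.ext fun a b => (R.aut.inv_mem hσ) a b

theorem OrderRel.perm_mul {E : Type u} (σ : Equiv.Perm E) (S : OrderRel E) :
    Corr.perm σ * S.rel = (S.conj σ).rel * Corr.perm σ :=
  Corr.ext fun a b => by
    simp only [Corr.mem_mul, Corr.mem_perm, OrderRel.mem_conj]
    constructor
    · rintro ⟨y, rfl, h⟩
      exact ⟨_, by simpa using h, rfl⟩
    · rintro ⟨y, h, rfl⟩
      exact ⟨σ.symm a, by simp, by simpa using h⟩

/-! ### The essential algebra and the algebra of permuted orders -/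

section Algebras

variable (k : Type v) [Field k] (E : Type u)

/-- Inessential relations become zero in the essential algebra. -/
inductive EssAlgRel : RelAlg k E → RelAlg k E → Prop
  | inessential (Q : Corr E E) (h : Q.Inessential) : EssAlgRel (MonoidAlgebra.of k _ Q) 0

/-- The essential algebra: the quotient of the algebra of relations `R_E` by the two-sided ideal
`I_E` spanned by the inessential relations. -/
def EssAlg : Type (max u v) := RingQuot (EssAlgRel k E)

instance : Ring (EssAlg k E) := inferInstanceAs (Ring (RingQuot (EssAlgRel k E)))

instance : Algebra k (EssAlg k E) := inferInstanceAs (Algebra k (RingQuot (EssAlgRel k E)))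

/-- The quotient map from the algebra of relations to the essential algebra. -/
def toEssAlg : RelAlg k E →ₐ[k] EssAlg k E := RingQuot.mkAlgHom k (EssAlgRel k E)

/-- A reflexive relation becomes equal to its transitive closure. -/
inductive PermAlgRel : EssAlg k E → EssAlg k E → Prop
  | closure (Q : Corr E E) (h : ∀ a, (a, a) ∈ Q) :
      PermAlgRel (toEssAlg k E (MonoidAlgebra.of k _ Q))
        (toEssAlg k E (MonoidAlgebra.of k _ Q.transClosure))

/-- The algebra `P_E` of permuted orders: the quotient of the essential algebra by the (nilpotent)
two-sided ideal generated by all `Q - Q̄`, where `Q` is a reflexive relation and `Q̄` its transitive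
closure. If `Q̄` is not an order, then it is inessential, so that `Q` and `Q̄` vanish in `P_E`.
Hence `P_E` has as a basis the `Δ_σ R` with `σ` a permutation and `R` an order, and the
product of two orders is the transitive closure of their union if this is an order, and zero
otherwise. -/
def PermAlg : Type (max u v) := RingQuot (PermAlgRel k E)

instance : Ring (PermAlg k E) := inferInstanceAs (Ring (RingQuot (PermAlgRel k E)))

instance : Algebra k (PermAlg k E) := inferInstanceAs (Algebra k (RingQuot (PermAlgRel k E)))

/-- The quotient map from the essential algebra to the algebra of permuted orders. -/
def essToPermAlg : EssAlg k E →ₐ[k] PermAlg k E := RingQuot.mkAlgHom k (PermAlgRel k E)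

/-- The canonical map from the algebra of relations to the algebra of permuted orders. -/
def toPermAlg : RelAlg k E →ₐ[k] PermAlg k E :=
  (essToPermAlg k E).comp (toEssAlg k E)

variable {E}

/-- The image in `P_E` of a relation on `E`. -/
def relP (Q : Corr E E) : PermAlg k E := toPermAlg k E (MonoidAlgebra.of k _ Q)

theorem relP_mul (Q S : Corr E E) : relP k (Q * S) = relP k Q * relP k S := by
  simp only [relP, map_mul]

variable [Finite E]

open Classical in
/-- The idempotent `f_R = ∑_{S ⊇ R} μ(R,S) S` of `P_E`, where `μ` is the Möbius function of the
poset of all orders on `E` (which vanishes at `(R,S)` unless `R ⊆ S`). -/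
def fIdem (R : OrderRel E) : PermAlg k E :=
  ∑ S : OrderRel E, IncidenceAlgebra.mu k R S • relP k S.rel

open Classical in
theorem mu_conj (σ : Equiv.Perm E) (R S : OrderRel E) :
    IncidenceAlgebra.mu k (R.conj σ) (S.conj σ) = IncidenceAlgebra.mu k R S := by
  induction S using WellFoundedLT.induction with
  | ind S ih =>
    rw [IncidenceAlgebra.mu_apply, IncidenceAlgebra.mu_apply (a := R)]
    have hinj : R.conj σ = S.conj σ ↔ R = S := (OrderRel.conjIso σ).injective.eq_iff
    simp only [hinj]
    split_ifs
    · rfl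
    · congr 1
      symm
      refine Finset.sum_equiv (OrderRel.conjIso σ).toEquiv (fun T => ?_) (fun T hT => ?_)
      · simp only [Finset.mem_Ico]
        exact and_congr (OrderRel.conjIso σ).le_iff_le.symm (OrderRel.conjIso σ).lt_iff_lt.symm
      · exact (ih T (Finset.mem_Ico.1 hT).2).symm

theorem perm_mul_fIdem (R : OrderRel E) (σ : R.aut) :
    relP k (Corr.perm σ.1) * fIdem k R = fIdem k R * relP k (Corr.perm σ.1) := by
  classical
  unfold fIdem
  rw [Finset.mul_sum, Finset.sum_mul]
  refine Finset.sum_equiv (OrderRel.conjIso σ.1).toEquiv (fun _ => by simp) (fun S _ => ?_)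
  change _ = IncidenceAlgebra.mu k R (S.conj σ.1) • relP k (S.conj σ.1).rel * _
  rw [mul_smul_comm, smul_mul_assoc, ← relP_mul, ← relP_mul, ← OrderRel.perm_mul]
  congr 1
  rw [← mu_conj k σ.1 R S, OrderRel.conj_eq_self σ.2]

end Algebras

/-! ### The fundamental module, the module `T_{R,V}` and the functor `S_{E,R,V}` -/

section Simple

variable (k : Type v) [Field k] {E : Type u} [Finite E] (R : OrderRel E)

/-- The fundamental module `P_E f_R`, a left ideal of `P_E`. -/
abbrev FundMod : Submodule (PermAlg k E) (PermAlg k E) :=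
  Submodule.span (PermAlg k E) {fIdem k R}

/-- The generator `f_R` of the fundamental module. -/
def FundMod.gen : FundMod k R := ⟨fIdem k R, Submodule.mem_span_singleton_self _⟩

/-- The right action of `Aut(E,R)` on the fundamental module, by right multiplication by `Δ_σ`. -/
def FundMod.rightMul (σ : R.aut) (x : FundMod k R) : FundMod k R :=
  ⟨x.1 * relP k (Corr.perm σ.1), by
    obtain ⟨p, hp⟩ := Submodule.mem_span_singleton.1 x.2
    refine Submodule.mem_span_singleton.2 ⟨p * relP k (Corr.perm σ.1), ?_⟩
    rw [← hp, smul_eq_mul, smul_eq_mul, mul_assoc, mul_assoc, perm_mul_fIdem]⟩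

variable (V : Type w) [AddCommGroup V] [Module k V] [Module (MonoidAlgebra k R.aut) V]

/-- The relations `xσ ⊗ y = x ⊗ σy` which define the tensor product over `k Aut(E,R)` as a
quotient of the tensor product over `k`. They are stable under the left action of `P_E`. -/
def TRel : Submodule (PermAlg k E) (FundMod k R ⊗[k] V) :=
  Submodule.span (PermAlg k E) {t | ∃ (x : FundMod k R) (σ : R.aut) (y : V),
    t = FundMod.rightMul k R σ x ⊗ₜ[k] y - x ⊗ₜ[k] (MonoidAlgebra.of k R.aut σ • y)}

/-- `T_{R,V} = P_E f_R ⊗_{k Aut(E,R)} V`. -/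
def TMod : Type (max u v w) := (FundMod k R ⊗[k] V) ⧸ TRel k R V

instance : AddCommGroup (TMod k R V) :=
  inferInstanceAs (AddCommGroup ((FundMod k R ⊗[k] V) ⧸ TRel k R V))

instance : Module (PermAlg k E) (TMod k R V) :=
  inferInstanceAs (Module (PermAlg k E) ((FundMod k R ⊗[k] V) ⧸ TRel k R V))

instance : Module k (TMod k R V) :=
  inferInstanceAs (Module k ((FundMod k R ⊗[k] V) ⧸ TRel k R V))

instance : IsScalarTower k (PermAlg k E) (TMod k R V) :=
  inferInstanceAs (IsScalarTower k (PermAlg k E) ((FundMod k R ⊗[k] V) ⧸ TRel k R V))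

/-- `T_{R,V}` as a module over the algebra of relations, through `R_E → P_E`. -/
instance : Module (RelAlg k E) (TMod k R V) :=
  Module.compHom _ (toPermAlg k E).toRingHom

theorem TMod.relAlg_smul_def (r : RelAlg k E) (t : TMod k R V) :
    r • t = toPermAlg k E r • t := rfl

instance : IsScalarTower k (RelAlg k E) (TMod k R V) where
  smul_assoc c r t := by
    simp only [TMod.relAlg_smul_def, map_smul, smul_assoc]

/-- The element `f_R ⊗ y` of `T_{R,V}`. -/
def TMod.gen (y : V) : TMod k R V := (TRel k R V).mkQ (FundMod.gen k R ⊗ₜ[k] y)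

/-- The correspondence functor `S_{E,R,V} = L_{E,T_{R,V}} / J_{E,T_{R,V}}`. -/
def simpleFunctor : FinCorr.{u} ⥤ ModuleCat.{max u v w} k :=
  SFunctor k E (TMod k R V)

/-- For a correspondence `U ∈ C(X,E)` and `y ∈ V`, the class of `U ⊗ f_R ⊗ y` in `S_{E,R,V}(X)`. -/
def simpleFunctor.elem (X : FinCorr.{u}) (U : Corr X.carrier E) (y : V) :
    (simpleFunctor k R V).obj X :=
  SObj.mk k E (TMod k R V) U (TMod.gen k R V y)

end Simple

/-- `Λ_φ = {(x,e) | (φ(x),e) ∈ R}`. -/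
def Lam {E X : Type u} (R : OrderRel E) (φ : X → E) : Corr X E :=
  ⟨{p : X × E | (φ p.1, p.2) ∈ R.rel}⟩

/-- `A` is a set of representatives of the orbits of `Aut(E,R)`, acting by composition on the left,
on the set of all surjective maps `X → E`. -/
def IsOrbitRepresentatives {E X : Type u} (R : OrderRel E) (A : Set (X → E)) : Prop :=
  (∀ φ ∈ A, Function.Surjective φ) ∧
    ∀ φ : X → E, Function.Surjective φ → ∃! ψ, ψ ∈ A ∧ ∃ σ ∈ R.aut, ψ = σ ∘ φ

end CorrFun

end

/-! Write `e ≤ f` for `(e, f) ∈ R`. The relations on `E` act on the free module over the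
permutations of `E`: the entry of `Q` at `(ρ, σ)` is 1 when `Δ_ρ Δ_σ⁻¹ ⊆ Q ⊆ Δ_ρ R Δ_σ⁻¹`, and 0
otherwise. This action factors through `P_E` and commutes with right translation by `Aut(E,R)`, and
column 1 of `f_R` is the unit vector at 1. Hence `x ⊗ y ↦ ∑_s x_{s,1} s y`, summed over `Aut(E,R)`,
is a well-defined map `T_{R,V} → V`.

Testing the class of `Λ_φ ⊗ f_R ⊗ v` against `Γ_ψ` and then applying this map gives the sum of `s v`
over those `s` for which `Γ_ψ Λ_φ` has entry 1 at `(s, 1)`. Such an `s` forces `ψ ≤ sφ` pointwise,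
and for `φ = ψ` only `s = 1` remains. On orbit representatives the system is therefore triangular
with `v` on the diagonal, which gives (b).

For (a), a simple `V` is cyclic, so the classes of `U ⊗ f_R ⊗ y` with `U ∈ C(X,E)` span the value at
`X`, and there are `2^(|E||X|)` of them. From below, (b) reduces the question to counting orbits of
surjections: there are at least `|E|^(|X|-|E|)` surjections, and each orbit has at most `|Aut(E,R)|`
elements. -/

noncomputable section

namespace CorrFun

/-! ### The action of relations on permutations determined by an order -/

section Rep

variable {E : Type u}

/-- The relation `Q` is squeezed between `Δ_ρ Δ_σ⁻¹` and `Δ_ρ R Δ_σ⁻¹`. -/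
def Fits (R : OrderRel E) (Q : Corr E E) (ρ σ : Equiv.Perm E) : Prop :=
  (∀ e, (ρ e, σ e) ∈ Q) ∧ ∀ e f, (ρ e, σ f) ∈ Q → (e, f) ∈ R.rel

variable {R : OrderRel E}

/-- A permutation of a finite poset which moves every element upwards is the identity. -/
theorem OrderRel.eq_one_of_forall_le [Finite E] {α : Equiv.Perm E}
    (h : ∀ e, (e, α e) ∈ R.rel) : α = 1 := by
  have hpow : ∀ (n : ℕ) e, (e, (α ^ n) e) ∈ R.rel := by
    intro n
    induction n with
    | zero => exact fun e => R.refl e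
    | succ n ih =>
      intro e
      rw [pow_succ', Equiv.Perm.mul_apply]
      exact R.trans _ _ _ (ih e) (h _)
  obtain ⟨n, hn, hα⟩ := isOfFinOrder_iff_pow_eq_one.1 (isOfFinOrder_of_finite α)
  ext e
  have h1 := hpow (n - 1) (α e)
  rw [← Equiv.Perm.mul_apply, ← pow_succ, Nat.sub_add_cancel hn, hα] at h1
  exact (R.antisymm _ _ (h e) h1).symm

theorem Fits.mul {Q S : Corr E E} {ρ τ σ : Equiv.Perm E} (hQ : Fits R Q ρ τ)
    (hS : Fits R S τ σ) : Fits R (Q * S) ρ σ := by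
  refine ⟨fun e => ⟨τ e, hQ.1 e, hS.1 e⟩, ?_⟩
  rintro e f ⟨y, h1, h2⟩
  obtain ⟨g, rfl⟩ := τ.surjective y
  exact R.trans _ _ _ (hQ.2 _ _ h1) (hS.2 _ _ h2)

/-- Comparing through `Q` gives `e ≤ τ⁻¹τ'(e)`, and comparing through `S` gives `τ⁻¹τ'(e) ≤ e`. With
`Fits.exists_middle`, a matrix product then has at most one nonzero term per entry, so
multiplicativity holds over any field. -/
theorem Fits.middle_unique {Q S : Corr E E} {ρ τ τ' σ : Equiv.Perm E} (hQ : Fits R Q ρ τ)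
    (hS : Fits R S τ σ) (hQ' : Fits R Q ρ τ') (hS' : Fits R S τ' σ) : τ = τ' := by
  ext e
  have h1 := hQ.2 e (τ.symm (τ' e)) (by simpa using hQ'.1 e)
  have h2 := hS.2 (τ.symm (τ' e)) e (by simpa using hS'.1 e)
  rw [R.antisymm _ _ h1 h2, Equiv.apply_symm_apply]
  have := R.antisymm _ _ h1 h2
  rw [← this]

/-- If a composite through `Y` fits, then `E` embeds into `Y`. -/
theorem Fits.exists_injective {Y : Type u} {A : Corr E Y} {B : Corr Y E} {ρ σ : Equiv.Perm E}
    (h : Fits R (Corr.comp A B) ρ σ) :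
    ∃ t : E → Y, Function.Injective t ∧ ∀ e, (ρ e, t e) ∈ A ∧ (t e, σ e) ∈ B := by
  choose t ht using h.1
  refine ⟨t, fun e f hef => ?_, ht⟩
  refine R.antisymm _ _ (h.2 _ _ ⟨t e, (ht e).1, ?_⟩) (h.2 _ _ ⟨t f, (ht f).1, ?_⟩)
  · exact hef ▸ (ht f).2
  · exact hef ▸ (ht e).2

/-- Intermediate points chosen along the diagonal are distinct, so on a finite set they form a
permutation. -/
theorem Fits.exists_middle [Finite E] {Q S : Corr E E} {ρ σ : Equiv.Perm E}
    (h : Fits R (Q * S) ρ σ) : ∃ τ, Fits R Q ρ τ ∧ Fits R S τ σ := by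
  obtain ⟨t, ht, hmem⟩ := Fits.exists_injective (A := Q) (B := S) h
  refine ⟨Equiv.ofBijective t (Finite.injective_iff_bijective.1 ht),
    ⟨fun e => (hmem e).1, fun e f hef => ?_⟩, ⟨fun e => (hmem e).2, fun e f hef => ?_⟩⟩
  · exact h.2 _ _ ⟨t f, hef, (hmem f).2⟩
  · exact h.2 _ _ ⟨t e, (hmem e).1, hef⟩

theorem Fits.not_inessential [Finite E] {Q : Corr E E} {ρ σ : Equiv.Perm E}
    (h : Fits R Q ρ σ) : ¬ Q.Inessential := by
  rintro ⟨Y, _, A, B, hlt, rfl⟩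
  obtain ⟨t, ht, -⟩ := h.exists_injective
  exact hlt.not_ge (Nat.card_le_card_of_injective t ht)

/-- Reflexivity puts `(ρ e, ρ e)` in `Q`, so `e ≤ σ⁻¹ρ(e)` for all `e`; a permutation moving every
element upwards is trivial. -/
theorem Fits.eq_of_refl [Finite E] {Q : Corr E E} (hQ : ∀ a, (a, a) ∈ Q) {ρ σ : Equiv.Perm E}
    (h : Fits R Q ρ σ) : ρ = σ := by
  have h1 : ρ.trans σ.symm = 1 :=
    R.eq_one_of_forall_le fun e => h.2 _ _ (by simpa using hQ (ρ e))
  ext e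
  have := congrArg σ (Equiv.ext_iff.1 h1 e)
  simpa using this

/-- Once `ρ = σ`, the upper bound `Δ_ρ R Δ_ρ⁻¹` is itself transitive, so it contains `Q` exactly
when it contains the closure. -/
theorem fits_transClosure_iff [Finite E] {Q : Corr E E} (hQ : ∀ a, (a, a) ∈ Q)
    {ρ σ : Equiv.Perm E} : Fits R Q.transClosure ρ σ ↔ Fits R Q ρ σ := by
  constructor
  · intro h
    obtain rfl := h.eq_of_refl fun a => Relation.TransGen.single (hQ a)
    exact ⟨fun e => hQ _, fun e f hef => h.2 _ _ (Relation.TransGen.single hef)⟩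
  · intro h
    obtain rfl := h.eq_of_refl hQ
    refine ⟨fun e => Relation.TransGen.single (hQ _), fun e f hef => ?_⟩
    have key : ∀ b, Relation.TransGen (fun a b => (a, b) ∈ Q) (ρ e) b →
        (e, ρ.symm b) ∈ R.rel := by
      intro b hb
      induction hb with
      | single hb => exact h.2 _ _ (by simpa using hb)
      | tail _ hb ih => exact R.trans _ _ _ ih (h.2 _ _ (by simpa using hb))
    simpa using key _ hef

theorem fits_mul_aut_iff {Q : Corr E E} {ρ σ τ : Equiv.Perm E} (hτ : τ ∈ R.aut) :
    Fits R Q (ρ * τ) (σ * τ) ↔ Fits R Q ρ σ := by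
  constructor
  · intro h
    refine ⟨fun e => by simpa using h.1 (τ.symm e), fun e f hef => ?_⟩
    have := (hτ _ _).2 (h.2 (τ.symm e) (τ.symm f) (by simpa using hef))
    simpa using this
  · intro h
    exact ⟨fun e => h.1 (τ e), fun e f hef => (hτ _ _).1 (h.2 _ _ hef)⟩

theorem fits_perm_one_iff {σ τ : Equiv.Perm E} : Fits R (Corr.perm σ) τ 1 ↔ τ = σ := by
  constructor
  · intro h
    ext e
    exact h.1 e
  · rintro rfl
    refine ⟨fun e => rfl, fun e f hef => ?_⟩
    rw [τ.injective (hef : τ e = τ f)]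
    exact R.refl f

theorem OrderRel.fits_one [Finite E] {S : OrderRel E} (hS : R ≤ S) {ρ : Equiv.Perm E} :
    Fits R S.rel ρ 1 ↔ ρ = 1 ∧ S = R := by
  constructor
  · intro h
    obtain rfl := h.eq_of_refl S.refl
    exact ⟨rfl, le_antisymm (OrderRel.le_def.2 h.2) hS⟩
  · rintro ⟨rfl, rfl⟩
    exact ⟨fun e => S.refl e, fun e f h => h⟩

/-! ### The matrix representation of `P_E` -/

variable [Fintype E] [DecidableEq E] (k : Type v) [Field k] (R)

open Classical in
/-- The matrix representation of the monoid of relations on `E` afforded by the permutations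
of `E` and the order `R`. -/
def corrRep : Corr E E →* Matrix (Equiv.Perm E) (Equiv.Perm E) k where
  toFun Q := Matrix.of fun ρ σ => if Fits R Q ρ σ then 1 else 0
  map_one' := by
    ext ρ σ
    simp only [Matrix.of_apply, Matrix.one_apply]
    refine if_congr ?_ rfl rfl
    constructor
    · intro h
      ext e
      exact h.1 e
    · rintro rfl
      refine ⟨fun e => rfl, fun e f hef => ?_⟩
      rw [ρ.injective (hef : ρ e = ρ f)]
      exact R.refl f
  map_mul' Q S := by
    ext ρ σ
    simp only [Matrix.of_apply, Matrix.mul_apply, ← ite_and, mul_ite, mul_one, mul_zero]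
    by_cases h : Fits R (Q * S) ρ σ
    · obtain ⟨τ, h1, h2⟩ := h.exists_middle
      rw [if_pos h, Finset.sum_eq_single τ, if_pos ⟨h2, h1⟩]
      · intro τ' _ hne
        exact if_neg fun h' => hne (h'.2.middle_unique h'.1 h1 h2)
      · simp
    · rw [if_neg h]
      exact (Finset.sum_eq_zero fun τ _ => if_neg fun h' => h (h'.2.mul h'.1)).symm

open Classical in
theorem corrRep_apply (Q : Corr E E) (ρ σ : Equiv.Perm E) :
    corrRep R k Q ρ σ = if Fits R Q ρ σ then 1 else 0 := rfl

/-- The matrix representation of the essential algebra. -/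
def essAlgRep : EssAlg k E →ₐ[k] Matrix (Equiv.Perm E) (Equiv.Perm E) k :=
  RingQuot.liftAlgHom k ⟨MonoidAlgebra.lift k _ _ (corrRep R k), by
    rintro _ _ ⟨Q, hQ⟩
    rw [MonoidAlgebra.lift_of, map_zero]
    ext ρ σ
    rw [corrRep_apply, if_neg fun h => h.not_inessential hQ, Matrix.zero_apply]⟩

theorem essAlgRep_toEssAlg (r : RelAlg k E) :
    essAlgRep R k (toEssAlg k E r) = MonoidAlgebra.lift k _ _ (corrRep R k) r :=
  RingQuot.liftAlgHom_mkAlgHom_apply _ _ _ _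

/-- The matrix representation of the algebra of permuted orders. -/
def permAlgRep : PermAlg k E →ₐ[k] Matrix (Equiv.Perm E) (Equiv.Perm E) k :=
  RingQuot.liftAlgHom k ⟨essAlgRep R k, by
    rintro _ _ ⟨Q, hQ⟩
    rw [essAlgRep_toEssAlg, essAlgRep_toEssAlg, MonoidAlgebra.lift_of, MonoidAlgebra.lift_of]
    ext ρ σ
    classical
    simp only [corrRep_apply, fits_transClosure_iff hQ]⟩

theorem permAlgRep_toPermAlg (r : RelAlg k E) :
    permAlgRep R k (toPermAlg k E r) = MonoidAlgebra.lift k _ _ (corrRep R k) r :=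
  (RingQuot.liftAlgHom_mkAlgHom_apply _ _ _ _).trans (essAlgRep_toEssAlg R k r)

theorem permAlgRep_relP (Q : Corr E E) : permAlgRep R k (relP k Q) = corrRep R k Q := by
  rw [relP, permAlgRep_toPermAlg, MonoidAlgebra.lift_of]

omit [Fintype E] [DecidableEq E] in
theorem toPermAlg_surjective : Function.Surjective (toPermAlg k E) :=
  (RingQuot.mkAlgHom_surjective k (PermAlgRel k E)).comp
    (RingQuot.mkAlgHom_surjective k (EssAlgRel k E))

variable {R} in
theorem permAlgRep_mul_aut {τ : Equiv.Perm E} (hτ : τ ∈ R.aut) (p : PermAlg k E)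
    (ρ σ : Equiv.Perm E) : permAlgRep R k p (ρ * τ) (σ * τ) = permAlgRep R k p ρ σ := by
  classical
  obtain ⟨r, rfl⟩ := toPermAlg_surjective k p
  rw [permAlgRep_toPermAlg]
  induction r using MonoidAlgebra.induction_on with
  | of Q =>
    rw [MonoidAlgebra.lift_of, corrRep_apply, corrRep_apply]
    simp only [fits_mul_aut_iff hτ]
  | add a b ha hb => simp only [map_add, Matrix.add_apply, ha, hb]
  | smul c a ha => simp only [map_smul, Matrix.smul_apply, ha]

theorem permAlgRep_mul_perm (p : PermAlg k E) (ρ σ : Equiv.Perm E) :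
    permAlgRep R k (p * relP k (Corr.perm σ)) ρ 1 = permAlgRep R k p ρ σ := by
  classical
  rw [map_mul, Matrix.mul_apply, permAlgRep_relP]
  simp [corrRep_apply, fits_perm_one_iff]

/-- Only `S = R` contributes to column 1: an order strictly containing `R` violates the upper bound,
and the Möbius function vanishes at orders not containing `R`. -/
theorem permAlgRep_fIdem (ρ : Equiv.Perm E) :
    permAlgRep R k (fIdem k R) ρ 1 = if ρ = 1 then 1 else 0 := by
  classical
  rw [fIdem, map_sum, Matrix.sum_apply, Finset.sum_eq_single R]
  · simp [permAlgRep_relP, corrRep_apply, OrderRel.fits_one le_rfl]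
  · intro S _ hS
    rw [map_smul, Matrix.smul_apply, permAlgRep_relP, corrRep_apply]
    by_cases hRS : R ≤ S
    · rw [if_neg fun h => hS ((OrderRel.fits_one hRS).1 h).2, smul_zero]
    · rw [IncidenceAlgebra.apply_eq_zero_of_not_le hRS, zero_smul]
  · simp

theorem permAlgRep_mul_fIdem (p : PermAlg k E) (ρ : Equiv.Perm E) :
    permAlgRep R k (p * fIdem k R) ρ 1 = permAlgRep R k p ρ 1 := by
  rw [map_mul, Matrix.mul_apply]
  simp [permAlgRep_fIdem]

end Rep

/-! ### A functional on `T_{R,V}` -/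

section Functional

variable (k : Type v) [Field k] {E : Type u} [Fintype E] [DecidableEq E] (R : OrderRel E)
  (V : Type w) [AddCommGroup V] [Module k V] [Module (MonoidAlgebra k R.aut) V]
  [IsScalarTower k (MonoidAlgebra k R.aut) V]

open Classical in
/-- The map `P_E f_R ⊗ V → V`, `x ⊗ y ↦ ∑_s x_{s,1} s y`, where `s` runs over `Aut(E,R)`. -/
def fundFunctional : FundMod k R ⊗[k] V →ₗ[k] V :=
  TensorProduct.lift (∑ s : R.aut,
    (LinearMap.lsmul k (Module.End k V) |>.flip
      (Algebra.lsmul k k V (MonoidAlgebra.of k R.aut s))) ∘ₗ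
      (Matrix.entryLinearMap k k s.1 1 ∘ₗ (permAlgRep R k).toLinearMap ∘ₗ
        ((FundMod k R).subtype.restrictScalars k)))

open Classical in
theorem fundFunctional_tmul (x : FundMod k R) (y : V) :
    fundFunctional k R V (x ⊗ₜ y)
      = ∑ s : R.aut, permAlgRep R k x.1 s.1 1 • MonoidAlgebra.of k R.aut s • y := by
  simp [fundFunctional, LinearMap.sum_apply]

/-- Reindex by `s ↦ sσ`: the entry of `x Δ_σ` at `(sσ, 1)` is that of `x` at `(sσ, σ)`, which equals
that at `(s, 1)` by invariance under automorphisms. -/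
theorem fundFunctional_rightMul (x : FundMod k R) (σ : R.aut) (y : V) :
    fundFunctional k R V (FundMod.rightMul k R σ x ⊗ₜ y)
      = fundFunctional k R V (x ⊗ₜ (MonoidAlgebra.of k R.aut σ • y)) := by
  classical
  rw [fundFunctional_tmul, fundFunctional_tmul]
  refine (Fintype.sum_equiv (Equiv.mulRight σ) _ _ fun s => ?_).symm
  rw [Equiv.coe_mulRight, map_mul, mul_smul]
  congr 1
  change _ = permAlgRep R k (x.1 * relP k (Corr.perm σ.1)) (s.1 * σ.1) 1
  rw [permAlgRep_mul_perm, ← permAlgRep_mul_aut k σ.2 x.1 s.1 1, one_mul]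

/-- `TRel` is a `P_E`-submodule while the functional is only `k`-linear; carrying an arbitrary
multiplier `p` lets the span induction pass through scalars. -/
theorem fundFunctional_smul_eq_zero (p : PermAlg k E) {t : FundMod k R ⊗[k] V}
    (ht : t ∈ TRel k R V) : fundFunctional k R V (p • t) = 0 := by
  induction ht using Submodule.span_induction generalizing p with
  | mem t h =>
    obtain ⟨x, σ, y, rfl⟩ := h
    rw [smul_sub, TensorProduct.smul_tmul', TensorProduct.smul_tmul', map_sub, sub_eq_zero,
      ← fundFunctional_rightMul]
    congr 2
    exact Subtype.ext (mul_assoc p x.1 _).symm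
  | zero => rw [smul_zero, map_zero]
  | add a b _ _ ha hb => rw [smul_add, map_add, ha, hb, add_zero]
  | smul q a _ ha => rw [← mul_smul]; exact ha _

/-- The map `T_{R,V} → V` induced by `x ⊗ y ↦ ∑_s x_{s,1} s y`. -/
def TMod.functional : TMod k R V →ₗ[k] V :=
  ((TRel k R V).restrictScalars k).liftQ (fundFunctional k R V) fun t ht => by
    simpa using fundFunctional_smul_eq_zero k R V 1 ht

open Classical in
theorem TMod.functional_smul_gen (Q : Corr E E) (y : V) :
    TMod.functional k R V (MonoidAlgebra.of k (Corr E E) Q • TMod.gen k R V y)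
      = ∑ s : R.aut, (if Fits R Q s.1 1 then (1 : k) else 0) • MonoidAlgebra.of k R.aut s • y := by
  have h : MonoidAlgebra.of k (Corr E E) Q • TMod.gen k R V y
      = (TRel k R V).mkQ ((relP k Q • FundMod.gen k R) ⊗ₜ y) := rfl
  rw [h]
  refine (fundFunctional_tmul k R V _ y).trans (Finset.sum_congr rfl fun s _ => ?_)
  congr 1
  refine (permAlgRep_mul_fIdem R k (relP k Q) s.1).trans ?_
  rw [permAlgRep_relP, corrRep_apply]

end Functional

/-! ### Testing elements of `S_{E,W}` against correspondences -/

section Test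

variable (k : Type v) [Field k] (E : Type u) (W : Type w) [AddCommGroup W] [Module k W]
  [Module (RelAlg k E) W] [IsScalarTower k (RelAlg k E) W]

/-- The map `S_{E,W}(X) → W`, `φ ⊗ x ↦ (ψφ)x`. -/
def SObj.test {X : Type u} (ψ : Corr E X) : SObj k E W X →ₗ[k] W :=
  (JObj k E W X).liftQ (LEval k E W ∘ₗ LMap k E W ψ) (iInf_le _ ψ)

theorem SObj.test_mk {X : Type u} (ψ : Corr E X) (φ : Corr X E) (x : W) :
    SObj.test k E W ψ (SObj.mk k E W φ x)
      = MonoidAlgebra.of k (Corr E E) (Corr.comp ψ φ) • x := by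
  change LEval k E W (LMap k E W ψ (LObj.mk k E W φ x)) = _
  rw [LMap_mk, LEval_mk]

end Test

/-! ### Linear independence -/

section Independence

variable {E : Type u} {R : OrderRel E} {X : Type u}

/-- `Γ_φ = {(e,x) | (e,φ(x)) ∈ R}`. -/
def Gam (R : OrderRel E) (φ : X → E) : Corr E X := ⟨{p : E × X | (p.1, φ p.2) ∈ R.rel}⟩

/-- The point `x` puts `(ψ x, φ x)` in the composite, and the upper bound in `Fits` then reads
`s⁻¹(ψ x) ≤ φ x`. -/
theorem fits_gam_lam {φ ψ : X → E} {s : Equiv.Perm E} (hs : s ∈ R.aut)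
    (h : Fits R (Corr.comp (Gam R ψ) (Lam R φ)) s 1) (x : X) : (ψ x, s (φ x)) ∈ R.rel := by
  have := h.2 (s.symm (ψ x)) (φ x)
    ⟨x, by rw [Equiv.apply_symm_apply]; exact R.refl (ψ x), R.refl (φ x)⟩
  simpa using (hs _ _).2 this

theorem fits_gam_lam_self {φ : X → E} (hφ : Function.Surjective φ) [Finite E]
    {s : Equiv.Perm E} : Fits R (Corr.comp (Gam R φ) (Lam R φ)) s 1 ↔ s = 1 := by
  have h : Corr.comp (Gam R φ) (Lam R φ) = R.rel := by
    refine Corr.ext fun a b => ⟨fun ⟨x, h1, h2⟩ => R.trans _ _ _ h1 h2, fun hab => ?_⟩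
    obtain ⟨x, rfl⟩ := hφ a
    exact ⟨x, R.refl _, hab⟩
  rw [h, OrderRel.fits_one le_rfl, and_iff_left rfl]

/-- Up to automorphisms of `(E,R)`, pointwise comparison of maps is a preorder. -/
abbrev pointwisePreorder (R : OrderRel E) (X : Type u) : Preorder (X → E) where
  le ψ φ := ∃ s ∈ R.aut, ∀ x, (ψ x, s (φ x)) ∈ R.rel
  le_refl φ := ⟨1, R.aut.one_mem, fun x => R.refl _⟩
  le_trans := by
    rintro χ ψ φ ⟨s, hs, h1⟩ ⟨t, ht, h2⟩
    exact ⟨s * t, R.aut.mul_mem hs ht, fun x => R.trans _ _ _ (h1 x) ((hs _ _).2 (h2 x))⟩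

/-- Antisymmetry up to automorphisms: `ψ ≤ sφ ≤ stψ` and surjectivity of `ψ` make `st` move every
element upwards, so `st = 1`. -/
theorem eq_comp_of_pointwise_le [Finite E] {φ ψ : X → E} (hψ : Function.Surjective ψ)
    {s t : Equiv.Perm E} (hs : s ∈ R.aut) (h1 : ∀ x, (ψ x, s (φ x)) ∈ R.rel)
    (h2 : ∀ x, (φ x, t (ψ x)) ∈ R.rel) : ψ = s ∘ φ := by
  have hst : s * t = 1 := R.eq_one_of_forall_le fun e => by
    obtain ⟨x, rfl⟩ := hψ e
    exact R.trans _ _ _ (h1 x) ((hs _ _).2 (h2 x))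
  funext x
  refine R.antisymm _ _ (h1 x) ?_
  have := (hs _ _).2 (h2 x)
  rwa [← Equiv.Perm.mul_apply, hst] at this

theorem linearIndependent_mk_lam (k : Type v) [Field k] [Finite E] (R : OrderRel E)
    (V : Type w) [AddCommGroup V] [Module k V] [Module (MonoidAlgebra k R.aut) V]
    [IsScalarTower k (MonoidAlgebra k R.aut) V] {y : V} (hy : y ≠ 0)
    {A : Set (X → E)} (hA : IsOrbitRepresentatives R A) :
    LinearIndependent k
      (fun φ : A => SObj.mk k E (TMod k R V) (Lam R φ.1) (TMod.gen k R V y)) := by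
  classical
  have := Fintype.ofFinite E
  rw [linearIndependent_iff']
  intro S g hg
  by_contra! hne
  obtain ⟨φ₁, hφ₁, hg₁⟩ := hne
  let _ := pointwisePreorder R X
  -- Testing a dependence against `Γ_ψ`, for `ψ` maximal in its support, leaves only the term at
  -- `ψ`.
  obtain ⟨ψ, hψ⟩ := (S.filter fun φ => g φ ≠ 0).exists_maximal
    ⟨φ₁, Finset.mem_filter.2 ⟨hφ₁, hg₁⟩⟩
  have hψS := Finset.mem_filter.1 hψ.1
  have hsurj := hA.1 ψ.1 ψ.2
  let F := TMod.functional k R V ∘ₗ SObj.test k E (TMod k R V) (Gam R ψ.1)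
  have hF (φ : A) : F (SObj.mk k E (TMod k R V) (Lam R φ.1) (TMod.gen k R V y))
      = ∑ s : R.aut, (if Fits R (Corr.comp (Gam R ψ.1) (Lam R φ.1)) s.1 1 then (1 : k) else 0) •
          MonoidAlgebra.of k R.aut s • y := by
    rw [← TMod.functional_smul_gen]
    exact congrArg _ (SObj.test_mk k E (TMod k R V) _ _ _)
  have h0 : ∑ φ ∈ S, g φ • F (SObj.mk k E (TMod k R V) (Lam R φ.1) (TMod.gen k R V y)) = 0 := by
    simpa only [map_sum, map_smul, map_zero] using congrArg F hg
  rw [Finset.sum_eq_single ψ] at h0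
  · rw [hF, Finset.sum_eq_single 1] at h0
    · rw [if_pos (show Fits R _ (1 : R.aut).1 1 from (fits_gam_lam_self hsurj).2 rfl), one_smul,
        map_one, one_smul] at h0
      exact (smul_ne_zero hψS.2 hy) h0
    · intro s _ hs
      rw [if_neg, zero_smul]
      rw [fits_gam_lam_self hsurj]
      exact fun h => hs (Subtype.ext h)
    · simp
  · intro φ hφ hne
    by_cases hgφ : g φ = 0
    · rw [hgφ, zero_smul]
    rw [hF, Finset.sum_eq_zero, smul_zero]
    intro s _
    rw [if_neg, zero_smul]
    intro hfit
    have h1 := fits_gam_lam s.2 hfit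
    -- A surviving `φ` lies above `ψ`, hence also below it by maximality; the two are then in one
    -- orbit and are the same representative.
    obtain ⟨t, -, h2⟩ := hψ.2 (Finset.mem_filter.2 ⟨hφ, hgφ⟩) ⟨s.1, s.2, h1⟩
    have heq := eq_comp_of_pointwise_le hsurj s.2 h1 h2
    have huniq := hA.2 ψ.1 hsurj
    refine hne (Subtype.ext (huniq.unique ⟨φ.2, s.1⁻¹, R.aut.inv_mem s.2, ?_⟩
      ⟨ψ.2, 1, R.aut.one_mem, rfl⟩))
    rw [heq]
    funext x
    simp
  · exact fun h => absurd hψS.1 h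

theorem linearIndependent_elem (k : Type v) [Field k] [Finite E] (R : OrderRel E)
    (V : Type w) [AddCommGroup V] [Module k V] [Module (MonoidAlgebra k R.aut) V]
    [IsScalarTower k (MonoidAlgebra k R.aut) V] (X : FinCorr.{u}) {y : V} (hy : y ≠ 0)
    {A : Set (X.carrier → E)} (hA : IsOrbitRepresentatives R A) :
    LinearIndependent k (fun φ : A => simpleFunctor.elem k R V X (Lam R φ.1) y) :=
  linearIndependent_mk_lam k R V hy hA

end Independence

/-! ### Dimension bounds -/

section Dimension

variable (k : Type v) [Field k] {E : Type u} [Finite E] (R : OrderRel E)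
  (V : Type w) [AddCommGroup V] [Module k V] [Module (MonoidAlgebra k R.aut) V]
  [IsScalarTower k (MonoidAlgebra k R.aut) V]

/-! ### Generators and the upper bound -/

omit [IsScalarTower k (MonoidAlgebra k R.aut) V] in
theorem TMod.gen_of_smul (σ : R.aut) (y : V) :
    TMod.gen k R V (MonoidAlgebra.of k R.aut σ • y)
      = relP k (Corr.perm σ.1) • TMod.gen k R V y := by
  have h : relP k (Corr.perm σ.1) • FundMod.gen k R
      = FundMod.rightMul k R σ (FundMod.gen k R) := Subtype.ext (perm_mul_fIdem k R σ)
  have h2 : relP k (Corr.perm σ.1) • TMod.gen k R V y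
      = (TRel k R V).mkQ ((relP k (Corr.perm σ.1) • FundMod.gen k R) ⊗ₜ y) := rfl
  rw [h2, h]
  exact ((Submodule.Quotient.eq (TRel k R V)).2
    (Submodule.subset_span (Set.mem_ofPred.2 ⟨FundMod.gen k R, σ, y, rfl⟩))).symm

omit [IsScalarTower k (MonoidAlgebra k R.aut) V] in
theorem TMod.gen_add (y z : V) :
    TMod.gen k R V (y + z) = TMod.gen k R V y + TMod.gen k R V z :=
  (congrArg (TRel k R V).mkQ (TensorProduct.tmul_add _ y z)).trans (map_add _ _ _)

omit [IsScalarTower k (MonoidAlgebra k R.aut) V] in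
theorem TMod.gen_smul (c : k) (y : V) : TMod.gen k R V (c • y) = c • TMod.gen k R V y :=
  congrArg (TRel k R V).mkQ (TensorProduct.tmul_smul c _ y)

/-- If `y` generates `V`, then `f_R ⊗ y` generates `T_{R,V}`. -/
theorem TMod.span_gen {y : V} (hy : Submodule.span (MonoidAlgebra k R.aut) {y} = ⊤)
    (t : TMod k R V) : ∃ r : RelAlg k E, r • TMod.gen k R V y = t := by
  have hgen (a : MonoidAlgebra k R.aut) :
      TMod.gen k R V (a • y) ∈ Submodule.span (PermAlg k E) {TMod.gen k R V y} := by
    induction a using MonoidAlgebra.induction_on with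
    | of σ =>
      rw [TMod.gen_of_smul]
      exact Submodule.smul_mem _ _ (Submodule.mem_span_singleton_self _)
    | add a b ha hb =>
      rw [add_smul, TMod.gen_add]
      exact Submodule.add_mem _ ha hb
    | smul c a ha =>
      have h : TMod.gen k R V ((c • a) • y)
          = algebraMap k (PermAlg k E) c • TMod.gen k R V (a • y) := by
        rw [algebraMap_smul, smul_assoc, TMod.gen_smul]
      rw [h]
      exact Submodule.smul_mem _ _ ha
  have hall : t ∈ Submodule.span (PermAlg k E) {TMod.gen k R V y} := by
    obtain ⟨z, rfl⟩ := (TRel k R V).mkQ_surjective t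
    induction z using TensorProduct.induction_on with
    | zero => rw [map_zero]; exact Submodule.zero_mem _
    | add a b ha hb => rw [map_add]; exact Submodule.add_mem _ ha hb
    | tmul x v =>
      obtain ⟨a, rfl⟩ := Submodule.mem_span_singleton.1 (hy ▸ Submodule.mem_top : v ∈ _)
      obtain ⟨p, hp⟩ := Submodule.mem_span_singleton.1 x.2
      have hx : x = p • FundMod.gen k R := Subtype.ext hp.symm
      rw [hx]
      exact Submodule.smul_mem _ p (hgen a)
  obtain ⟨p, rfl⟩ := Submodule.mem_span_singleton.1 hall
  obtain ⟨r, rfl⟩ := toPermAlg_surjective k p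
  exact ⟨r, rfl⟩

theorem span_elem_eq_top {y : V} (hy : Submodule.span (MonoidAlgebra k R.aut) {y} = ⊤)
    (X : FinCorr.{u}) :
    Submodule.span k (Set.range fun U => simpleFunctor.elem k R V X U y) = ⊤ := by
  have hmem (U : Corr X.carrier E) (t : TMod k R V) : SObj.mk k E (TMod k R V) U t ∈
      Submodule.span k (Set.range fun U => SObj.mk k E (TMod k R V) U (TMod.gen k R V y)) := by
    obtain ⟨r, rfl⟩ := TMod.span_gen k R V hy t
    induction r using MonoidAlgebra.induction_on with
    | of ρ =>
      -- A relation acting on `f_R ⊗ y` is absorbed into `U` across the tensor product.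
      rw [SObj.mk, ← LObj.mk_comp]
      exact Submodule.subset_span ⟨Corr.comp U ρ, rfl⟩
    | add a b ha hb =>
      rw [add_smul, SObj.mk, LObj.mk, TensorProduct.tmul_add, map_add, map_add]
      exact Submodule.add_mem _ ha hb
    | smul c a ha =>
      rw [smul_assoc, SObj.mk, LObj.mk, TensorProduct.tmul_smul, map_smul, map_smul]
      exact Submodule.smul_mem _ _ ha
  refine Submodule.eq_top_iff'.2 fun s => ?_
  obtain ⟨l, rfl⟩ := (JObj k E (TMod k R V) X.carrier).mkQ_surjective s
  obtain ⟨z, rfl⟩ := (LRel k E (TMod k R V) X.carrier).mkQ_surjective l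
  induction z using TensorProduct.induction_on with
  | zero => rw [map_zero, map_zero]; exact Submodule.zero_mem _
  | add a b ha hb =>
    rw [map_add, map_add]
    exact Submodule.add_mem _ ha hb
  | tmul a t =>
    induction (Lin.basis k X.carrier E).mem_span a using Submodule.span_induction with
    | mem a h => obtain ⟨U, rfl⟩ := h; exact hmem U t
    | zero => rw [TensorProduct.zero_tmul, map_zero, map_zero]; exact Submodule.zero_mem _
    | add a b _ _ ha hb =>
      rw [TensorProduct.add_tmul, map_add, map_add]
      exact Submodule.add_mem _ ha hb
    | smul c a _ ha =>
      rw [← TensorProduct.smul_tmul', map_smul, map_smul]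
      exact Submodule.smul_mem _ c ha

theorem card_corr (Y X : Type u) [Finite Y] [Finite X] :
    Nat.card (Corr Y X) = (2 ^ Nat.card X) ^ Nat.card Y := by
  have e : Corr Y X ≃ Set (Y × X) := ⟨Corr.graph, Corr.mk, fun _ => rfl, fun _ => rfl⟩
  rw [Nat.card_congr e, ← pow_mul, mul_comm, ← Nat.card_prod]
  have := Fintype.ofFinite (Y × X)
  simp [Nat.card_eq_fintype_card]

/-- A generator of `V` bounds the dimension of `S_{E,R,V}(X)`. -/
theorem finrank_le {y : V} (hy : Submodule.span (MonoidAlgebra k R.aut) {y} = ⊤)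
    (X : FinCorr.{u}) : FiniteDimensional k ((simpleFunctor k R V).obj X) ∧
      Module.finrank k ((simpleFunctor k R V).obj X) ≤ (2 ^ Nat.card E) ^ Nat.card X.carrier := by
  have hspan := span_elem_eq_top k R V hy X
  have := Fintype.ofFinite (Corr X.carrier E)
  refine ⟨Module.Finite.of_fg_top (hspan ▸ Submodule.fg_span (Set.finite_range _)), ?_⟩
  rw [← card_corr, Nat.card_eq_fintype_card]
  exact finrank_le_of_span_eq_top hspan

/-! ### Counting orbits of surjections -/

omit [Finite E] in
theorem exists_orbitRepresentatives (X : Type u) :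
    ∃ A : Set (X → E), IsOrbitRepresentatives R A := by
  let s : Setoid {φ : X → E // Function.Surjective φ} :=
    { r := fun φ ψ => ∃ σ ∈ R.aut, φ.1 = σ ∘ ψ.1
      iseqv :=
        { refl := fun φ => ⟨1, R.aut.one_mem, rfl⟩
          symm := by
            rintro φ ψ ⟨σ, hσ, h⟩
            exact ⟨σ⁻¹, R.aut.inv_mem hσ, by rw [h]; funext x; simp⟩
          trans := by
            rintro φ ψ χ ⟨σ, hσ, h⟩ ⟨τ, hτ, h'⟩
            exact ⟨σ * τ, R.aut.mul_mem hσ hτ, by rw [h, h']; rfl⟩ } }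
  refine ⟨Set.range fun q : Quotient s => q.out.1, ?_, fun φ hφ => ?_⟩
  · rintro _ ⟨q, rfl⟩
    exact q.out.2
  · refine ⟨(Quotient.mk s ⟨φ, hφ⟩).out.1, ⟨⟨_, rfl⟩, Quotient.mk_out (s := s) ⟨φ, hφ⟩⟩, ?_⟩
    rintro _ ⟨⟨q, rfl⟩, h⟩
    have : q = Quotient.mk s ⟨φ, hφ⟩ := by
      rw [← q.out_eq]
      exact Quotient.sound h
    rw [this]

/-- A surjection is recovered from its representative and an automorphism carrying it there. -/
theorem card_surjective_le {X : Type u} [Finite X] {A : Set (X → E)}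
    (hA : IsOrbitRepresentatives R A) :
    Nat.card {φ : X → E // Function.Surjective φ} ≤ Nat.card R.aut * Nat.card A := by
  rw [← Nat.card_prod]
  choose r hr using fun φ : {φ : X → E // Function.Surjective φ} => (hA.2 φ.1 φ.2).exists
  choose hrA σ hσ hrσ using hr
  refine Nat.card_le_card_of_injective
    (fun φ => ((⟨σ φ, hσ φ⟩, ⟨r φ, hrA φ⟩) : R.aut × A)) fun φ ψ h => ?_
  simp only [Prod.mk.injEq, Subtype.mk.injEq] at h
  have h1 := hrσ φ
  rw [h.2, hrσ ψ, h.1] at h1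
  exact Subtype.ext (funext fun x => (σ ψ).injective (congrFun h1 x).symm)

/-- Fix an embedding `i : E → X`. Overwriting `f` by `i⁻¹` on the image of `i` makes it surjective,
and the lost values are recorded by `f ∘ i`. -/
theorem card_pow_le_card_surjective {X : Type u} [Finite X] (h : Nat.card E ≤ Nat.card X) :
    Nat.card E ^ Nat.card X
      ≤ Nat.card {φ : X → E // Function.Surjective φ} * Nat.card E ^ Nat.card E := by
  classical
  have := Fintype.ofFinite E
  have := Fintype.ofFinite X
  obtain ⟨i⟩ : Nonempty (E ↪ X) :=
    Function.Embedding.nonempty_of_card_le (by simpa [Nat.card_eq_fintype_card] using h)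
  rw [← Nat.card_fun, ← Nat.card_fun, ← Nat.card_prod]
  refine Nat.card_le_card_of_injective (fun f : X → E =>
    ((⟨Function.extend i _root_.id f, fun e => ⟨i e, i.injective.extend_apply _ _ _⟩⟩, f ∘ i) :
      {φ : X → E // Function.Surjective φ} × (E → E))) fun f g hfg => ?_
  funext x
  by_cases hx : ∃ e, i e = x
  · obtain ⟨e, rfl⟩ := hx
    exact congrFun (congrArg Prod.snd hfg) e
  · have := congrFun (congrArg (fun p => p.1.1) hfg) x
    dsimp only at this
    rwa [Function.extend_apply' _ _ _ hx, Function.extend_apply' _ _ _ hx] at this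

end Dimension

end CorrFun
end

open CorrFun in
theorem mainTheorem3 {k : Type v} [Field k] {E : Type u} [Finite E] (R : OrderRel E)
    (V : Type w) [AddCommGroup V] [Module k V] [Module (MonoidAlgebra k R.aut) V]
    [IsScalarTower k (MonoidAlgebra k R.aut) V] [IsSimpleModule (MonoidAlgebra k R.aut) V] :
    (∃ N : ℕ, 0 < N ∧ ∃ c : ℝ, 0 < c ∧ ∀ X : FinCorr.{u}, N ≤ Nat.card X.carrier →
      FiniteDimensional k ((simpleFunctor k R V).obj X) ∧
      c * (Nat.card E : ℝ) ^ Nat.card X.carrier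
        ≤ (Module.finrank k ((simpleFunctor k R V).obj X) : ℝ) ∧
      Module.finrank k ((simpleFunctor k R V).obj X)
        ≤ (2 ^ Nat.card E) ^ Nat.card X.carrier) ∧
    (∀ (X : FinCorr.{u}) (y : V), y ≠ 0 → ∀ A : Set (X.carrier → E),
      IsOrbitRepresentatives R A →
      LinearIndependent k
        (fun φ : A => simpleFunctor.elem k R V X (Lam R φ.1) y)) := by
  refine ⟨?_, fun X y hy A hA => linearIndependent_elem k R V X hy hA⟩
  have := IsSimpleModule.nontrivial (MonoidAlgebra k R.aut) V
  obtain ⟨y, hy⟩ := exists_ne (0 : V)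
  have hspan := IsSimpleModule.span_singleton_eq_top (MonoidAlgebra k R.aut) hy
  -- The identity map gives `|E|^|E| > 0` even for empty `E`.
  have : Nonempty (E → E) := ⟨_root_.id⟩
  have hpos : 0 < Nat.card R.aut * Nat.card E ^ Nat.card E :=
    Nat.mul_pos Nat.card_pos (Nat.card_fun (α := E) (β := E) ▸ Nat.card_pos)
  -- The count needs only `|X| ≥ |E|`; the extra 1 keeps `N` positive when `E` is empty.
  refine ⟨Nat.card E + 1, Nat.succ_pos _,
    ((Nat.card R.aut * Nat.card E ^ Nat.card E : ℕ) : ℝ)⁻¹,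
    inv_pos.2 (Nat.cast_pos.2 hpos), fun X hX => ?_⟩
  obtain ⟨hfin, hle⟩ := finrank_le k R V hspan X
  refine ⟨hfin, ?_, hle⟩
  obtain ⟨A, hA⟩ := exists_orbitRepresentatives R X.carrier
  have := Fintype.ofFinite A
  have hA' : Nat.card A ≤ Module.finrank k ((simpleFunctor k R V).obj X) := by
    rw [Nat.card_eq_fintype_card]
    exact (linearIndependent_elem k R V X hy hA).fintype_card_le_finrank
  rw [inv_mul_le_iff₀ (Nat.cast_pos.2 hpos)]
  have hcard : Nat.card E ^ Nat.card X.carrier ≤ Nat.card R.aut * Nat.card E ^ Nat.card E *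
      Module.finrank k ((simpleFunctor k R V).obj X) :=
    calc Nat.card E ^ Nat.card X.carrier
        ≤ Nat.card {φ : X.carrier → E // Function.Surjective φ} * Nat.card E ^ Nat.card E :=
          card_pow_le_card_surjective (by omega)
      _ ≤ Nat.card R.aut * Nat.card A * Nat.card E ^ Nat.card E := by
          gcongr
          exact card_surjective_le R hA
      _ = Nat.card R.aut * Nat.card E ^ Nat.card E * Nat.card A := by ring
      _ ≤ _ := by gcongr
  exact_mod_cast hcard
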